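/- For a complex $*$-algebra $A$ (unital, with conjugate-linear involution) let $\Sigma^2A=\{\sum_{i=1}^k a_i^*a_i : k\in\mathbb N,\ a_i\in A\}$, and call $b\in A$ hermitian if $b^*=b$. A finite-dimensional $*$-representation of $A$ is a unital $\mathbb C$-algebra homomorphism $\pi\colon A\to M_m(\mathbb C)$, $m\in\mathbb N$, with $\pi(a^*)=\pi(a)^*$ (conjugate transpose) for all $a\in A$. Theorem 6.1 (Schmüdgen; Helton). Let $X$ be a set, finite or infinite. Let $A$ be any of the following $*$-algebras: (1) the group algebra $\mathbb C[F_X]$ of the free group $F_X$ on $X$ (so $F_X=F_n$ if $|X|=n$), with $\left(\sum_g a_g g\right)^*=\sum_g \overline{a_g}\,g^{-1}$; (2) the algebra $\mathbb C\langle y_i,z_i : i\in X\rangle$ of polynomials in non-commuting variables, with the involution determined by $y_i^*=z_i$; (3) the algebra $\mathbb C\langle z_i : i\in X\rangle$ of polynomials in non-commuting variables, with the involution determined by $z_i^*=z_i$. If $b\in A$ is hermitian and $\pi(b)$ is a positive semidefinite matrix for every finite-dimensional $*$-representation $\pi$ of $A$, then $b\in\Sigma^2A$. -/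

import Mathlib

open scoped ComplexOrder

namespace FreeSOS

section StarAlgebras

variable {A : Type*} [Ring A] [StarRing A] [Algebra ℂ A]

/-- The set `Σ² A` of (finite) sums of hermitian squares `∑ aᵢ* aᵢ` in a `*`-algebra. -/
def sumHermSq (A : Type*) [Ring A] [StarRing A] : Set A :=
  {b | ∃ (k : ℕ) (a : Fin k → A), b = ∑ i, star (a i) * a i}

/-- `b` is mapped to a positive semidefinite matrix by every finite-dimensional (unital)
`*`-representation `A → M_m(ℂ)`, the involution on `M_m(ℂ)` being the conjugate transpose. -/
def PosSemidefInFinDimReps (b : A) : Prop :=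
  ∀ (m : ℕ) (π : A →⋆ₐ[ℂ] Matrix (Fin m) (Fin m) ℂ), (π b).PosSemidef

end StarAlgebras

section MonoidAlgebras

variable {M : Type*} [Monoid M]

/-- For an involution `σ` of `M`, the map `∑ a_w w ↦ ∑ conj(a_w) σ(w)` on `ℂ[M]`, that is,
the coefficient of `∑ a_w w` at `w` becomes `conj (a_{σ w})`. -/
noncomputable def conjMap (σ : M ≃ M) (a : MonoidAlgebra ℂ M) : MonoidAlgebra ℂ M :=
  MonoidAlgebra.ofCoeff ((a.coeff.equivMapDomain σ).mapRange (starRingEnd ℂ) (map_zero _))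

theorem conjMap_add (σ : M ≃ M) (a b : MonoidAlgebra ℂ M) :
    conjMap σ (a + b) = conjMap σ a + conjMap σ b := by
  ext w
  simp [conjMap]

theorem conjMap_smul (σ : M ≃ M) (c : ℂ) (a : MonoidAlgebra ℂ M) :
    conjMap σ (c • a) = starRingEnd ℂ c • conjMap σ a := by
  ext w
  simp [conjMap]

theorem conjMap_single (σ : M ≃ M) (w : M) (c : ℂ) :
    conjMap σ (MonoidAlgebra.single w c) = MonoidAlgebra.single (σ w) (starRingEnd ℂ c) := by
  classical
  ext v
  by_cases h : σ w = v <;> simp [conjMap, h]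

/-- The involution `(∑ a_w w)* = ∑ conj(a_w) σ(w)` on `ℂ[M]`, for an anti-multiplicative
involution `σ` of the monoid `M`. -/
noncomputable abbrev starRingOf (σ : M ≃ M) (hinv : ∀ w, σ (σ w) = w)
    (hmul : ∀ v w, σ (v * w) = σ w * σ v) : StarRing (MonoidAlgebra ℂ M) where
  star := conjMap σ
  star_involutive a := by
    have h : ∀ w, σ.symm w = σ w := fun w => by rw [Equiv.symm_apply_eq, hinv]
    ext w
    simp [conjMap, h, hinv]
  star_add := conjMap_add σ
  star_mul a b := by
    induction a using MonoidAlgebra.induction_linear with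
    | zero => simp [show conjMap σ 0 = 0 by ext w; simp [conjMap]]
    | add a a' h h' => rw [add_mul, conjMap_add, h, h', conjMap_add, mul_add]
    | single v c =>
      induction b using MonoidAlgebra.induction_linear with
      | zero => simp [show conjMap σ 0 = 0 by ext w; simp [conjMap]]
      | add a a' h h' => rw [mul_add, conjMap_add, h, h', conjMap_add, add_mul]
      | single w d =>
        simp [conjMap_single, MonoidAlgebra.single_mul_single, hmul, mul_comm]

end MonoidAlgebras

section GroupAlgebra

variable {G : Type*} [Group G]

/-- The involution `(∑ a_g g)* = ∑ conj(a_g) g⁻¹` of the group algebra `ℂ[G]`. -/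
noncomputable instance groupAlgebraStarRing : StarRing (MonoidAlgebra ℂ G) :=
  starRingOf (Equiv.inv G) inv_inv mul_inv_rev

theorem groupAlgebra_star_single (g : G) (c : ℂ) :
    star (MonoidAlgebra.single g c) = MonoidAlgebra.single g⁻¹ (starRingEnd ℂ c) :=
  conjMap_single _ g c

end GroupAlgebra

section FreeAlgebras

variable {X : Type*}

/-- Reversal of words. -/
def wordRev (X : Type*) : FreeMonoid X ≃ FreeMonoid X where
  toFun w := FreeMonoid.ofList w.toList.reverse
  invFun w := FreeMonoid.ofList w.toList.reverse
  left_inv w := by simp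
  right_inv w := by simp

/-- Reversal of words, together with the exchange of the letters `y_i = inl i` and
`z_i = inr i`. -/
def wordRevSwap (X : Type*) : FreeMonoid (X ⊕ X) ≃ FreeMonoid (X ⊕ X) where
  toFun w := FreeMonoid.ofList (w.toList.map Sum.swap).reverse
  invFun w := FreeMonoid.ofList (w.toList.map Sum.swap).reverse
  left_inv w := by simp
  right_inv w := by simp

/-- The algebra `ℂ⟨z_i : i ∈ X⟩` of polynomials in non-commuting variables, regarded as a
`*`-algebra with `z_i* = z_i`. -/
def HermFreeAlgebra (X : Type*) : Type _ := MonoidAlgebra ℂ (FreeMonoid X)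

namespace HermFreeAlgebra

noncomputable instance : Ring (HermFreeAlgebra X) :=
  inferInstanceAs (Ring (MonoidAlgebra ℂ (FreeMonoid X)))

noncomputable instance : Algebra ℂ (HermFreeAlgebra X) :=
  inferInstanceAs (Algebra ℂ (MonoidAlgebra ℂ (FreeMonoid X)))

noncomputable instance : StarRing (HermFreeAlgebra X) :=
  starRingOf (wordRev X) (fun w => by simp [wordRev])
    (fun v w => by simp [wordRev])

/-- The variable `z_i`. -/
noncomputable def z (i : X) : HermFreeAlgebra X := MonoidAlgebra.single (FreeMonoid.of i) (1 : ℂ)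

theorem star_z (i : X) : star (z i) = z i :=
  (conjMap_single (wordRev X) (FreeMonoid.of i) 1).trans (by simp [wordRev, z])

theorem star_smul (c : ℂ) (a : HermFreeAlgebra X) : star (c • a) = starRingEnd ℂ c • star a :=
  conjMap_smul (wordRev X) c a

end HermFreeAlgebra

/-- The algebra `ℂ⟨y_i, z_i : i ∈ X⟩` of polynomials in non-commuting variables, regarded as a
`*`-algebra with `y_i* = z_i`. -/
def PairFreeAlgebra (X : Type*) : Type _ := MonoidAlgebra ℂ (FreeMonoid (X ⊕ X))

namespace PairFreeAlgebra

noncomputable instance : Ring (PairFreeAlgebra X) :=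
  inferInstanceAs (Ring (MonoidAlgebra ℂ (FreeMonoid (X ⊕ X))))

noncomputable instance : Algebra ℂ (PairFreeAlgebra X) :=
  inferInstanceAs (Algebra ℂ (MonoidAlgebra ℂ (FreeMonoid (X ⊕ X))))

noncomputable instance : StarRing (PairFreeAlgebra X) :=
  starRingOf (wordRevSwap X) (fun w => by simp [wordRevSwap])
    (fun v w => by simp [wordRevSwap])

/-- The variable `y_i`. -/
noncomputable def y (i : X) : PairFreeAlgebra X :=
  MonoidAlgebra.single (FreeMonoid.of (Sum.inl i)) (1 : ℂ)

/-- The variable `z_i`. -/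
noncomputable def z (i : X) : PairFreeAlgebra X :=
  MonoidAlgebra.single (FreeMonoid.of (Sum.inr i)) (1 : ℂ)

theorem star_y (i : X) : star (y i) = z i :=
  (conjMap_single (wordRevSwap X) (FreeMonoid.of (Sum.inl i)) 1).trans
    (by simp [wordRevSwap, z])

theorem star_smul (c : ℂ) (a : PairFreeAlgebra X) : star (c • a) = starRingEnd ℂ c • star a :=
  conjMap_smul (wordRevSwap X) c a

end PairFreeAlgebra

end FreeAlgebras

end FreeSOS

open Matrix

namespace FreeSOS


/-! ### Separation of a non-square from the sums of squares. -/

section Separation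

/-! Suppose `b` is hermitian but not a sum of hermitian squares. Fix a finite set `S` of words,
closed under suffixes, containing `1` and the support of `b`. In a sum of squares from the span of
`S` the leading terms cannot cancel, so these sums form a cone with compact base. Hahn–Banach then
gives a hermitian functional `l`, strictly positive on nonzero squares from the span, with `l b`
negative (`exists_separating_functional`).

The form `⟨u, v⟩ = l (u* v)` is an inner product on the span (`exists_gns_vectors`), with
independent vectors `x w` for `w ∈ S`. Left multiplication by a generator is only partially defined
there. For a free group it is a partial isometric map and extends to a unitary
(`exists_unitary_map_eq`). For polynomials it extends to an operator whose adjoint is also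
prescribed (`exists_map_eq_and_star_map_eq`). As the generators are free, any such extensions define
a `*`-representation, and induction along suffixes shows that `w` sends `x 1` to `x w`. Hence `⟨x 1,
π(b) x 1⟩ = l b` has negative real part, contradicting positivity of `π(b)`. -/

theorem sum_star_mul_self_mem_sumHermSq {A : Type*} [Ring A] [StarRing A]
    {ι : Type*} [Fintype ι] (a : ι → A) :
    ∑ i, star (a i) * a i ∈ sumHermSq A :=
  ⟨Fintype.card ι, fun j => a ((Fintype.equivFin ι).symm j),
    (Equiv.sum_comp (Fintype.equivFin ι).symm fun i => star (a i) * a i).symm⟩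

variable {A : Type*} [Ring A] [StarRing A] [Algebra ℂ A] [StarModule ℂ A] {M : Type*}

theorem smul_mem_sumHermSq {r : ℝ} (hr : 0 ≤ r) {b : A} (hb : b ∈ sumHermSq A) :
    (r : ℂ) • b ∈ sumHermSq A := by
  obtain ⟨k, a, rfl⟩ := hb
  refine ⟨k, fun i => ((√r : ℝ) : ℂ) • a i, ?_⟩
  rw [Finset.smul_sum]
  refine Finset.sum_congr rfl fun i _ => ?_
  rw [star_smul, smul_mul_smul_comm, Complex.star_def, Complex.conj_ofReal, ← Complex.ofReal_mul,
    Real.mul_self_sqrt hr]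

/-- The element `∑ c_v v` of the span of finitely many elements. -/
noncomputable def combo {ι : Type*} [Fintype ι] (f : ι → A) (c : ι → ℂ) : A := ∑ v, c v • f v

/-- The element `∑ G_{uv} f_u* f_v` with Gram matrix `G`. -/
noncomputable def gramMap {ι : Type*} [Fintype ι] (f : ι → A) : Matrix ι ι ℂ →ₗ[ℂ] A where
  toFun G := ∑ u, ∑ v, G u v • (star (f u) * f v)
  map_add' G H := by simp [add_smul, Finset.sum_add_distrib]
  map_smul' c G := by simp [mul_smul, Finset.smul_sum]

theorem star_combo_mul_combo {ι : Type*} [Fintype ι] (f : ι → A) (c d : ι → ℂ) :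
    star (combo f c) * combo f d = gramMap f (vecMulVec (star c) d) := by
  simp [combo, gramMap, Finset.sum_mul_sum, star_sum, star_smul, smul_smul,
    vecMulVec_apply, mul_comm]

/-- The rows of `B` serve as coefficient vectors. Sums of squares thereby become a linear image of
the positive semidefinite cone. -/
theorem gramMap_conjTranspose_mul_self {ι : Type*} [Fintype ι] (f : ι → A) (B : Matrix ι ι ℂ) :
    gramMap f (Bᴴ * B) = ∑ k, star (combo f (B k)) * combo f (B k) := by
  simp only [star_combo_mul_combo, ← map_sum]
  congr 1
  ext u v
  simp [Matrix.mul_apply, Matrix.sum_apply, vecMulVec_apply]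

open scoped MatrixOrder in
theorem exists_eq_conjTranspose_mul_self {ι : Type*} [Fintype ι] {G : Matrix ι ι ℂ}
    (hG : G.PosSemidef) : ∃ B : Matrix ι ι ℂ, G = Bᴴ * B := by
  classical
  exact CStarAlgebra.nonneg_iff_eq_star_mul_self.1 hG.nonneg

/-- Pairs of a positive semidefinite matrix and a nonnegative number, of total mass one. -/
def spectraplex (ι : Type*) [Fintype ι] : Set (Matrix ι ι ℂ × ℝ) :=
  {p | p.1.PosSemidef ∧ 0 ≤ p.2 ∧ p.1.trace.re + p.2 = 1}

theorem convex_spectraplex (ι : Type*) [Fintype ι] : Convex ℝ (spectraplex ι) := by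
  rintro ⟨G, s⟩ ⟨hG, hs, h⟩ ⟨H, t⟩ ⟨hH, ht, h'⟩ p q hp hq hpq
  refine ⟨?_, ?_, ?_⟩
  · exact (hG.smul hp).add (hH.smul hq)
  · simp only [Prod.snd_add, Prod.smul_mk, smul_eq_mul]; positivity
  · simp only [Prod.smul_mk, Prod.mk_add_mk, trace_add, trace_smul, Complex.add_re, Complex.smul_re,
      smul_eq_mul] at h h' ⊢
    linear_combination p * h + q * h' + hpq

theorem trace_conjTranspose_mul_self_re {ι : Type*} [Fintype ι] (B : Matrix ι ι ℂ) :
    (Bᴴ * B).trace.re = ∑ j, ∑ i, ‖B i j‖ ^ 2 := by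
  simp [Matrix.trace, Matrix.mul_apply, ← Complex.normSq_eq_conj_mul_self,
    Complex.normSq_eq_norm_sq, -Complex.ofReal_pow]

/-- The trace of `Bᴴ * B` is the squared Frobenius norm, so the set is the image of a Euclidean unit
sphere under `(B, s) ↦ (Bᴴ * B, s ^ 2)`. -/
theorem isCompact_spectraplex (ι : Type*) [Fintype ι] : IsCompact (spectraplex ι) := by
  classical
  let K : Set ((ι → ι → ℂ) × ℝ) := {p | ∑ j, ∑ i, ‖p.1 i j‖ ^ 2 + p.2 ^ 2 = 1}
  have hK : IsCompact K := by
    refine (isCompact_closedBall (0 : (ι → ι → ℂ) × ℝ) 1).of_isClosed_subset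
      (isClosed_eq (by fun_prop) continuous_const) ?_
    rintro ⟨B, s⟩ (h : ∑ j, ∑ i, ‖B i j‖ ^ 2 + s ^ 2 = 1)
    have hnn : 0 ≤ ∑ j, ∑ i, ‖B i j‖ ^ 2 := by positivity
    rw [mem_closedBall_zero_iff, Prod.norm_def, max_le_iff]
    constructor
    · refine (pi_norm_le_iff_of_nonneg zero_le_one).2 fun i =>
        (pi_norm_le_iff_of_nonneg zero_le_one).2 fun j => ?_
      have h1 : ‖B i j‖ ^ 2 ≤ ∑ i, ‖B i j‖ ^ 2 :=
        Finset.single_le_sum (f := fun i => ‖B i j‖ ^ 2) (fun _ _ => by positivity)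
          (Finset.mem_univ i)
      have h2 : ∑ i, ‖B i j‖ ^ 2 ≤ ∑ j, ∑ i, ‖B i j‖ ^ 2 :=
        Finset.single_le_sum (f := fun j => ∑ i, ‖B i j‖ ^ 2) (fun _ _ => by positivity)
          (Finset.mem_univ j)
      exact (sq_le_one_iff₀ (norm_nonneg _)).1 (by nlinarith [sq_nonneg s])
    · rw [Real.norm_eq_abs, ← sq_le_one_iff_abs_le_one]
      linarith
  have himg : spectraplex ι =
      (fun p : (ι → ι → ℂ) × ℝ => (((of p.1)ᴴ * of p.1, p.2 ^ 2) : Matrix ι ι ℂ × ℝ)) '' K := by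
    ext ⟨G, s⟩
    constructor
    · rintro ⟨hG, hs, h⟩
      obtain ⟨B, rfl⟩ := exists_eq_conjTranspose_mul_self hG
      refine ⟨(B, √s), ?_, ?_⟩
      · simp only at h hs
        change ∑ j, ∑ i, ‖B i j‖ ^ 2 + √s ^ 2 = 1
        rw [Real.sq_sqrt hs, ← trace_conjTranspose_mul_self_re, h]
      · simp only at hs
        simp only [Real.sq_sqrt hs]
        rfl
    · rintro ⟨⟨B, t⟩, h, heq⟩
      obtain ⟨rfl, rfl⟩ := Prod.mk.inj heq
      refine ⟨posSemidef_conjTranspose_mul_self _, sq_nonneg t, ?_⟩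
      rw [trace_conjTranspose_mul_self_re]
      exact h
  rw [himg]
  refine hK.image ?_
  have h : Continuous fun p : (ι → ι → ℂ) × ℝ => (of p.1 : Matrix ι ι ℂ) := continuous_fst
  exact (h.matrix_conjTranspose.matrix_mul h).prodMk (by fun_prop)

/-- If `b` is not a sum of hermitian squares, it is separated from the sums of squares of elements
of the span of a finite set `S` by a functional which is strictly positive on these. -/
theorem exists_separating_functional (e : Module.Basis M ℂ A) (S : Finset M)
    (hS : ∀ B : Matrix S S ℂ,
      ∑ k, star (combo (fun v : S => e v) (B k)) * combo (fun v : S => e v) (B k) = 0 → B = 0)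
    {b : A} (hb : star b = b) (hb' : b ∉ sumHermSq A) :
    ∃ l : A →ₗ[ℂ] ℂ, (∀ a, l (star a) = star (l a)) ∧
      (∀ c : S → ℂ, c ≠ 0 →
        0 < (l (star (combo (fun v : S => e v) c) * combo (fun v : S => e v) c)).re) ∧
      (l b).re < 0 := by
  classical
  set f : S → A := fun v => e v with hf
  -- `A` carries no topology; the product of the coordinate lines provides a locally convex one.
  -- Continuity of `coords ∘ₗ Ψ` is then automatic, its domain being finite-dimensional.
  let coords : A →ₗ[ℝ] (M → ℂ) :=
    ((Finsupp.lcoeFun (R := ℂ) (M := ℂ) (α := M)).comp e.repr.toLinearMap).restrictScalars ℝ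
  have hcoords : Function.Injective coords := fun x y h =>
    e.repr.injective (DFunLike.coe_injective h)
  let Ψ : Matrix S S ℂ × ℝ →ₗ[ℝ] A :=
    ((gramMap f).restrictScalars ℝ).comp (LinearMap.fst ℝ _ _) -
      (LinearMap.toSpanSingleton ℝ A b).comp (LinearMap.snd ℝ _ _)
  have hΨ : ∀ G s, Ψ (G, s) = gramMap f G - (s : ℂ) • b := fun G s => by
    simp [Ψ]
  have h0 : (0 : M → ℂ) ∉ (coords ∘ₗ Ψ) '' spectraplex S := by
    rintro ⟨⟨G, s⟩, ⟨hG, hs, h⟩, h0⟩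
    have h1 : Ψ (G, s) = 0 := hcoords (by simpa using h0)
    obtain ⟨B, rfl⟩ := exists_eq_conjTranspose_mul_self hG
    rw [hΨ, sub_eq_zero] at h1
    simp only at hs h
    -- For `s = 0` a vanishing sum of squares forces `B = 0`, against total mass one; for `s > 0`
    -- division by `s` exhibits `b` as a sum of squares.
    rcases hs.eq_or_lt with rfl | hs
    · have hB := hS B (by rw [← gramMap_conjTranspose_mul_self, h1]; simp)
      simp [hB] at h
    · refine hb' ?_
      have h2 : b = ((s⁻¹ : ℝ) : ℂ) • gramMap f (Bᴴ * B) := by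
        rw [h1, smul_smul, ← Complex.ofReal_mul, inv_mul_cancel₀ hs.ne', Complex.ofReal_one,
          one_smul]
      rw [h2, gramMap_conjTranspose_mul_self]
      exact smul_mem_sumHermSq (inv_nonneg.2 hs.le) (sum_star_mul_self_mem_sumHermSq _)
  have hcont : Continuous (coords ∘ₗ Ψ) := LinearMap.continuous_of_finiteDimensional _
  obtain ⟨g, r, hr, hg⟩ := geometric_hahn_banach_point_closed
    ((convex_spectraplex S).linear_image (coords ∘ₗ Ψ))
    ((isCompact_spectraplex S).image hcont).isClosed h0
  have hpos : ∀ G s, (G, s) ∈ spectraplex S → 0 < g (coords (Ψ (G, s))) := fun G s h => by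
    have := hg _ ⟨_, h, rfl⟩
    rw [map_zero] at hr
    exact hr.trans this
  let L : A →ₗ[ℝ] ℝ := g.toLinearMap ∘ₗ coords
  let l₀ : A →ₗ[ℂ] ℂ := Module.Dual.extendRCLike (𝕜 := ℂ) L
  have hl₀ : ∀ a, (l₀ a).re = L a := fun a => Module.Dual.re_extendRCLike_apply (𝕜 := ℂ) L a
  -- Averaging with the adjoint functional makes `l` hermitian without changing real parts at
  -- hermitian elements.
  let l : A →ₗ[ℂ] ℂ :=
    { toFun := fun a => (l₀ a + star (l₀ (star a))) / 2
      map_add' := fun a a' => by simp only [star_add, map_add]; ring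
      map_smul' := fun c a => by
        simp only [star_smul, map_smul, smul_eq_mul, star_mul', star_star, RingHom.id_apply]; ring }
  have hl : ∀ a, star a = a → (l a).re = L a := fun a ha => by
    change ((l₀ a + star (l₀ (star a))) / 2).re = _
    rw [ha, ← hl₀]
    simp
  refine ⟨l, fun a => ?_, fun c hc => ?_, ?_⟩
  · change (l₀ (star a) + star (l₀ (star (star a)))) / 2 = star ((l₀ a + star (l₀ (star a))) / 2)
    simp [add_comm]
  · rw [hl _ (by simp), star_combo_mul_combo]
    have hN : 0 < ∑ v, ‖c v‖ ^ 2 := by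
      obtain ⟨v, hv⟩ := Function.ne_iff.1 hc
      exact Finset.sum_pos' (fun _ _ => by positivity)
        ⟨v, Finset.mem_univ v, by have := norm_pos_iff.2 hv; positivity⟩
    have htr : (vecMulVec (star c) c).trace.re = ∑ v, ‖c v‖ ^ 2 := by
      simp [Matrix.trace, vecMulVec_apply, ← Complex.normSq_eq_conj_mul_self,
        Complex.normSq_eq_norm_sq, -Complex.ofReal_pow]
    -- The rank-one Gram matrix of `c` is scaled to trace one to lie in the spectraplex.
    have := hpos ((∑ v, ‖c v‖ ^ 2)⁻¹ • vecMulVec (star c) c) 0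
      ⟨(posSemidef_vecMulVec_star_self c).smul (inv_nonneg.2 hN.le), le_rfl, by
        simp only [trace_smul, Complex.smul_re, htr, smul_eq_mul, add_zero]
        exact inv_mul_cancel₀ hN.ne'⟩
    have h3 : Ψ ((∑ v, ‖c v‖ ^ 2)⁻¹ • vecMulVec (star c) c, 0) =
        (∑ v, ‖c v‖ ^ 2)⁻¹ • gramMap f (vecMulVec (star c) c) := by
      simp [Ψ]
    rw [h3, map_smul, map_smul, smul_eq_mul] at this
    exact pos_of_mul_pos_right this (inv_nonneg.2 hN.le)
  · rw [hl _ hb]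
    have := hpos 0 1 ⟨PosSemidef.zero, zero_le_one, by simp⟩
    rw [hΨ] at this
    have h4 : (0 : ℝ) < -L b := by simpa [L] using this
    linarith

end Separation

/-! ### The GNS construction on a finite-dimensional span. -/

section Gram

/-- A finite-dimensional inner product space embeds in some `ℂⁿ`. -/
theorem exists_linearMap_euclideanSpace {V : Type*} [AddCommGroup V] [Module ℂ V]
    [FiniteDimensional ℂ V] (c : InnerProductSpace.Core ℂ V) :
    ∃ (n : ℕ) (φ : V →ₗ[ℂ] EuclideanSpace ℂ (Fin n)),
      ∀ x y, inner ℂ (φ x) (φ y) = c.inner x y := by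
  let _ : NormedAddCommGroup V := c.toNormedAddCommGroup
  let _ : InnerProductSpace ℂ V := InnerProductSpace.ofCore c.toCore
  exact ⟨_, (stdOrthonormalBasis ℂ V).repr.toLinearEquiv.toLinearMap,
    fun x y => (stdOrthonormalBasis ℂ V).repr.inner_map_map x y⟩

variable {A : Type*} [Ring A] [StarRing A] [Algebra ℂ A] [StarModule ℂ A]

/-- The Gelfand–Naimark–Segal construction on the span of a finite family. -/
theorem exists_gns_vectors {ι : Type*} [Fintype ι] (f : ι → A) (l : A →ₗ[ℂ] ℂ)
    (hl : ∀ a, l (star a) = star (l a))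
    (hpos : ∀ c : ι → ℂ, c ≠ 0 → 0 < (l (star (combo f c) * combo f c)).re) :
    ∃ (n : ℕ) (x : ι → EuclideanSpace ℂ (Fin n)), LinearIndependent ℂ x ∧
      ∀ u v, inner ℂ (x u) (x v) = l (star (f u) * f v) := by
  classical
  have hadd : ∀ c d, combo f (c + d) = combo f c + combo f d := fun c d => by
    simp [combo, add_smul, Finset.sum_add_distrib]
  have hsmul : ∀ (r : ℂ) c, combo f (r • c) = r • combo f c := fun r c => by
    simp [combo, mul_smul, Finset.smul_sum]
  have hsingle : ∀ u, combo f (Pi.single u 1) = f u := fun u => by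
    simp [combo, Pi.single_apply]
  have hnn : ∀ c : ι → ℂ, 0 ≤ (l (star (combo f c) * combo f c)).re := fun c => by
    rcases eq_or_ne c 0 with rfl | hc
    · simp [combo]
    · exact (hpos c hc).le
  -- Strict positivity makes the form definite: there are no null vectors to divide out, and the
  -- resulting family stays linearly independent.
  let core : InnerProductSpace.Core ℂ (ι → ℂ) :=
    { inner := fun c d => l (star (combo f c) * combo f d)
      conj_inner_symm := fun c d => by
        rw [starRingEnd_apply, ← hl, star_mul, star_star]
      re_inner_nonneg := hnn
      add_left := fun c d d' => by rw [hadd, star_add, add_mul, map_add]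
      smul_left := fun c d r => by
        rw [hsmul, star_smul, smul_mul_assoc, map_smul, smul_eq_mul, starRingEnd_apply]
      definite := fun c h => by
        by_contra hc
        have := hpos c hc
        rw [show l (star (combo f c) * combo f c) = 0 from h] at this
        simp at this }
  obtain ⟨n, φ, hφ⟩ := exists_linearMap_euclideanSpace core
  have hinj : LinearMap.ker φ = ⊥ := by
    rw [LinearMap.ker_eq_bot']
    intro c hc
    refine core.definite c ?_
    rw [← hφ, hc, inner_zero_left]
  refine ⟨n, fun u => φ (Pi.single u 1), ?_, fun u v => ?_⟩
  · exact (Pi.linearIndependent_single_one ι ℂ).map' φ hinj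
  · rw [hφ]
    change l (star (combo f _) * combo f _) = _
    rw [hsingle, hsingle]

end Gram


/-! ### Extension of partially defined operators in finite dimension. -/

section Operators

variable {E : Type*} [NormedAddCommGroup E] [InnerProductSpace ℂ E] [FiniteDimensional ℂ E]

/-- Two families with the same Gram matrix are conjugate by a unitary. -/
theorem exists_unitary_map_eq {ι : Type*} [Finite ι] {x y : ι → E} (hx : LinearIndependent ℂ x)
    (h : ∀ i j, inner ℂ (y i) (y j) = inner ℂ (x i) (x j)) :
    ∃ U : unitary (E →L[ℂ] E), ∀ i, (U : E →L[ℂ] E) (x i) = y i := by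
  have := Fintype.ofFinite ι
  let B := Module.Basis.span hx
  have hB : ∀ i, (B i : E) = x i := fun i => by rw [Module.Basis.span_apply]
  let T : Submodule.span ℂ (Set.range x) →ₗ[ℂ] E := B.constr ℂ y
  have hT : ∀ i, T (B i) = y i := fun i => B.constr_basis ℂ y i
  have hin : ∀ v w, inner ℂ (T v) (T w) = inner ℂ v w := fun v w => by
    rw [← B.sum_repr v, ← B.sum_repr w]
    simp only [map_sum, map_smul, sum_inner, inner_sum, inner_smul_left, inner_smul_right, hT, h,
      Submodule.coe_inner, hB]
  let W : E →ₗᵢ[ℂ] E := (T.isometryOfInner hin).extend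
  refine ⟨Unitary.linearIsometryEquiv.symm (W.toLinearIsometryEquiv rfl), fun i => ?_⟩
  have h1 : W (x i) = y i := by
    rw [← hB, LinearIsometry.extend_apply]
    exact hT i
  simpa using h1

theorem _root_.LinearIndependent.exists_continuousLinearMap_map_eq {ι : Type*} {x : ι → E}
    (hx : LinearIndependent ℂ x) (y : ι → E) : ∃ T : E →L[ℂ] E, ∀ i, T (x i) = y i := by
  obtain ⟨T, hT⟩ := ((Module.Basis.span hx).constr ℂ y).exists_extend
  refine ⟨T.toContinuousLinearMap, fun i => ?_⟩
  have h := LinearMap.congr_fun hT (Module.Basis.span hx i)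
  rw [Module.Basis.constr_basis] at h
  simpa [Module.Basis.span_apply] using h

theorem starProjection_span_eq_zero {ι : Type*} {x : ι → E} {v : E}
    (hv : ∀ i, inner ℂ (x i) v = 0) :
    (Submodule.span ℂ (Set.range x)).starProjection v = 0 := by
  refine (Submodule.starProjection_apply_eq_zero_iff _).2 ((Submodule.mem_orthogonal _ _).2 ?_)
  intro u hu
  induction hu using Submodule.span_induction with
  | mem u hu => obtain ⟨i, rfl⟩ := hu; exact hv i
  | zero => simp
  | add u w _ _ hu hw => rw [inner_add_left, hu, hw, add_zero]
  | smul c u _ hu => rw [inner_smul_left, hu, mul_zero]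

/-- An operator and its adjoint may be prescribed on two linearly independent families, as soon as
the prescribed values are compatible. -/
theorem exists_map_eq_and_star_map_eq {ι κ : Type*} {x y : ι → E} {x' y' : κ → E}
    (hx : LinearIndependent ℂ x) (hx' : LinearIndependent ℂ x')
    (h : ∀ i j, inner ℂ (x' j) (y i) = inner ℂ (y' j) (x i)) :
    ∃ Z : E →L[ℂ] E, (∀ i, Z (x i) = y i) ∧ ∀ j, star Z (x' j) = y' j := by
  obtain ⟨T, hT⟩ := hx.exists_continuousLinearMap_map_eq y
  obtain ⟨T', hT'⟩ := hx'.exists_continuousLinearMap_map_eq y'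
  let P : E →L[ℂ] E := (Submodule.span ℂ (Set.range x)).starProjection
  let Q : E →L[ℂ] E := (Submodule.span ℂ (Set.range x')).starProjection
  have hPs : star P = P := isStarProjection_starProjection.isSelfAdjoint
  have hQs : star Q = Q := isStarProjection_starProjection.isSelfAdjoint
  have hP : ∀ i, P (x i) = x i := fun i =>
    Submodule.starProjection_eq_self_iff.2 (Submodule.subset_span ⟨i, rfl⟩)
  have hQ : ∀ j, Q (x' j) = x' j := fun j =>
    Submodule.starProjection_eq_self_iff.2 (Submodule.subset_span ⟨j, rfl⟩)
  have hstar : ∀ (R : E →L[ℂ] E) v w, inner ℂ v (star R w) = inner ℂ (R v) w := fun R v w => by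
    rw [ContinuousLinearMap.star_eq_adjoint, ContinuousLinearMap.adjoint_inner_right]
  -- This is `(1 - Q) T P + Q T'*`: the component in the range of `Q` is dictated by the prescribed
  -- adjoint, the rest by `T`. Compatibility says that `Q T'*` and `Q T` agree on the `x i`.
  refine ⟨T * P + star (T' * Q) - Q * T * P, fun i => ?_, fun j => ?_⟩
  · have h0 := starProjection_span_eq_zero (x := x') (v := star T' (x i) - y i) fun j => by
      rw [inner_sub_right, hstar, hT', h, sub_self]
    replace h0 := sub_eq_zero.1 ((map_sub _ _ _).symm.trans h0)
    change Q _ = Q _ at h0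
    simp [hQs, hP, hT, h0]
  · have h0 := starProjection_span_eq_zero (x := x) (v := star T (x' j) - y' j) fun i => by
      rw [inner_sub_right, hstar, hT, ← inner_conj_symm, h, inner_conj_symm, sub_self]
    replace h0 := sub_eq_zero.1 ((map_sub _ _ _).symm.trans h0)
    change P _ = P _ at h0
    simp [hPs, hQs, hQ, hT', h0, mul_assoc]

end Operators


/-! ### The abstract Positivstellensatz, given leading words and dilations. -/

section Criterion

variable {A : Type*} [Ring A] [StarRing A] [Algebra ℂ A]

theorem PosSemidefInFinDimReps.inner_nonneg {b : A} (hb : PosSemidefInFinDimReps b) {n : ℕ}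
    (π : A →⋆ₐ[ℂ] (EuclideanSpace ℂ (Fin n) →L[ℂ] EuclideanSpace ℂ (Fin n)))
    (x : EuclideanSpace ℂ (Fin n)) : 0 ≤ (inner ℂ x (π b x)).re := by
  have h := hb n ((Matrix.toEuclideanCLM (n := Fin n) (𝕜 := ℂ)).symm.toStarAlgHom.comp π)
  have h1 := h.re_dotProduct_nonneg x.ofLp
  have h2 : inner ℂ x (π b x) =
      star x.ofLp ⬝ᵥ ((toEuclideanCLM (n := Fin n) (𝕜 := ℂ)).symm (π b)) *ᵥ x.ofLp := by
    conv_lhs => rw [← (toEuclideanCLM (n := Fin n) (𝕜 := ℂ)).apply_symm_apply (π b)]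
    rw [EuclideanSpace.inner_eq_star_dotProduct, ofLp_toEuclideanCLM, dotProduct_comm]
  rw [h2]
  exact h1

variable [StarModule ℂ A] {M : Type*} [Monoid M]

@[elab_as_elim]
theorem _root_.Module.Basis.induction_linear {A : Type*} [AddCommGroup A] [Module ℂ A]
    {M : Type*} (e : Module.Basis M ℂ A) {p : A → Prop} (a : A)
    (zero : p 0) (add : ∀ a a', p a → p a' → p (a + a')) (smul : ∀ (c : ℂ) a, p a → p (c • a))
    (basis : ∀ u, p (e u)) : p a := by
  have ha : a ∈ Submodule.span ℂ (Set.range e) := by rw [e.span_eq]; trivial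
  induction ha using Submodule.span_induction with
  | mem a h => obtain ⟨u, rfl⟩ := h; exact basis u
  | zero => exact zero
  | add a a' _ _ h h' => exact add a a' h h'
  | smul c a _ h => exact smul c a h

/-- The `*`-homomorphism defined by a `*`-representation of a monoid whose elements form a basis. -/
noncomputable def starLift (e : Module.Basis M ℂ A) (he1 : e 1 = 1)
    (hemul : ∀ u v, e (u * v) = e u * e v) {σ : M → M} (hσ : ∀ w, star (e w) = e (σ w))
    {B : Type*} [Ring B] [StarRing B] [Algebra ℂ B] [StarModule ℂ B] (ρ : M →* B)
    (hρ : ∀ w, ρ (σ w) = star (ρ w)) : A →⋆ₐ[ℂ] B :=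
  { AlgHom.ofLinearMap (e.constr ℂ ρ) (by rw [← he1, e.constr_basis, map_one]) (fun a b => by
      induction a using e.induction_linear with
      | zero => simp
      | add a a' h h' => rw [add_mul, map_add, h, h', map_add, add_mul]
      | smul c a h => rw [smul_mul_assoc, map_smul, h, map_smul, smul_mul_assoc]
      | basis u =>
        induction b using e.induction_linear with
        | zero => simp
        | add a a' h h' => rw [mul_add, map_add, h, h', map_add, mul_add]
        | smul c a h => rw [mul_smul_comm, map_smul, h, map_smul, mul_smul_comm]
        | basis v => simp only [← hemul, e.constr_basis, map_mul]) with
    map_star' := fun a => by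
      change e.constr ℂ ρ (star a) = star (e.constr ℂ ρ a)
      induction a using e.induction_linear with
      | zero => simp
      | add a a' h h' => rw [star_add, map_add, h, h', map_add, star_add]
      | smul c a h => rw [star_smul, map_smul, h, map_smul, star_smul]
      | basis u => rw [hσ, e.constr_basis, e.constr_basis, hρ] }

theorem starLift_basis (e : Module.Basis M ℂ A) (he1 : e 1 = 1)
    (hemul : ∀ u v, e (u * v) = e u * e v) {σ : M → M} (hσ : ∀ w, star (e w) = e (σ w))
    {B : Type*} [Ring B] [StarRing B] [Algebra ℂ B] [StarModule ℂ B] (ρ : M →* B)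
    (hρ : ∀ w, ρ (σ w) = star (ρ w)) (w : M) : starLift e he1 hemul hσ ρ hρ (e w) = ρ w :=
  e.constr_basis ℂ ρ w

/-- No cancellation occurs in sums of hermitian squares, if every finite set of monomials contains
a `w` such that `w* w` arises only from squares. -/
theorem eq_zero_of_sum_star_combo_mul_combo (e : Module.Basis M ℂ A)
    (hemul : ∀ u v, e (u * v) = e u * e v) {σ : M → M} (hσ : ∀ w, star (e w) = e (σ w))
    (hlead : ∀ T : Finset M, T.Nonempty →
      ∃ w ∈ T, ∀ u ∈ T, ∀ v ∈ T, σ u * v = σ w * w → u = v)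
    (S : Finset M) (B : Matrix S S ℂ)
    (hB : ∑ k, star (combo (fun v : S => e v) (B k)) * combo (fun v : S => e v) (B k) = 0) :
    B = 0 := by
  classical
  by_contra hne
  -- Only words that occur with a nonzero coefficient count. For the `w` that `hlead` picks among
  -- them, the coefficient of `σ w * w` is a sum of terms `‖B k u‖ ^ 2`, including all `‖B k w‖ ^
  -- 2`.
  let T : Finset M := (Finset.univ.filter fun v : S => ∃ k, B k v ≠ 0).image Subtype.val
  have hT : ∀ {k v}, B k v ≠ 0 → (v : M) ∈ T := fun {k v} h =>
    Finset.mem_image_of_mem _ (Finset.mem_filter.2 ⟨Finset.mem_univ _, k, h⟩)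
  have hTne : T.Nonempty := by
    by_contra h
    refine hne (Matrix.ext fun k v => ?_)
    by_contra hkv
    exact h ⟨_, hT hkv⟩
  obtain ⟨w, hwT, hw⟩ := hlead T hTne
  obtain ⟨⟨w, hwS⟩, hw', rfl⟩ := Finset.mem_image.1 hwT
  obtain ⟨k₀, hk₀⟩ := (Finset.mem_filter.1 hw').2
  have hsum : ∀ k, e.coord (σ w * w)
      (star (combo (fun v : S => e v) (B k)) * combo (fun v : S => e v) (B k)) =
        ((∑ u : S, if σ u * u = σ w * w then ‖B k u‖ ^ 2 else 0 : ℝ) : ℂ) := fun k => by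
    simp only [star_combo_mul_combo, gramMap, LinearMap.coe_mk, AddHom.coe_mk, map_sum, map_smul,
      hσ, ← hemul, vecMulVec_apply, Module.Basis.coord_apply, e.repr_self, Finsupp.single_apply,
      Complex.ofReal_sum]
    refine Finset.sum_congr rfl fun u _ => ?_
    rw [Finset.sum_eq_single u]
    · split_ifs
      · simp [← Complex.normSq_eq_conj_mul_self, Complex.normSq_eq_norm_sq]
      · simp
    · intro v _ hvu
      by_cases hu0 : B k u = 0
      · simp [hu0]
      by_cases hv0 : B k v = 0
      · simp [hv0]
      rw [if_neg fun h => hvu (Subtype.ext (hw u (hT hu0) v (hT hv0) h).symm), smul_zero]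
    · simp
  have h := congrArg (e.coord (σ w * w)) hB
  rw [map_sum, map_zero, Finset.sum_congr rfl fun k _ => hsum k, ← Complex.ofReal_sum,
    Complex.ofReal_eq_zero] at h
  have hnn : ∀ k (u : S), 0 ≤ if σ u * u = σ w * w then ‖B k u‖ ^ 2 else 0 := fun k u => by
    split_ifs <;> positivity
  have h1 := (Finset.sum_eq_zero_iff_of_nonneg fun k _ =>
    Finset.sum_nonneg fun u _ => hnn k u).1 h k₀ (Finset.mem_univ _)
  have h2 := (Finset.sum_eq_zero_iff_of_nonneg fun u _ => hnn k₀ u).1 h1 ⟨w, hwS⟩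
    (Finset.mem_univ _)
  simp only [if_true] at h2
  exact hk₀ (norm_eq_zero.1 (pow_eq_zero_iff two_ne_zero |>.1 h2))

/-- A Positivstellensatz for monoid algebras with involution in which every positive definite
kernel on a suitable finite set of monomials dilates to a finite-dimensional `*`-representation. -/
theorem mem_sumHermSq_of_posSemidefInFinDimReps (e : Module.Basis M ℂ A) (he1 : e 1 = 1)
    (hemul : ∀ u v, e (u * v) = e u * e v) {σ : M → M} (hσ : ∀ w, star (e w) = e (σ w))
    (hlead : ∀ T : Finset M, T.Nonempty →
      ∃ w ∈ T, ∀ u ∈ T, ∀ v ∈ T, σ u * v = σ w * w → u = v)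
    {S : Finset M} (h1 : 1 ∈ S)
    (hdil : ∀ (n : ℕ) (x : S → EuclideanSpace ℂ (Fin n)), LinearIndependent ℂ x →
      (∀ u v u' v' : S, σ u * v = σ u' * v' → inner ℂ (x u) (x v) = inner ℂ (x u') (x v')) →
      ∃ ρ : M →* (EuclideanSpace ℂ (Fin n) →L[ℂ] EuclideanSpace ℂ (Fin n)),
        (∀ w, ρ (σ w) = star (ρ w)) ∧ ∀ w : S, ρ w (x ⟨1, h1⟩) = x w)
    {b : A} (hbS : (e.repr b).support ⊆ S) (hb : star b = b) (hpos : PosSemidefInFinDimReps b) :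
    b ∈ sumHermSq A := by
  by_contra hb'
  obtain ⟨l, hl, hlpos, hlb⟩ := exists_separating_functional e S
    (eq_zero_of_sum_star_combo_mul_combo e hemul hσ hlead S) hb hb'
  obtain ⟨n, x, hx, hgram⟩ := exists_gns_vectors (fun v : S => e v) l hl hlpos
  obtain ⟨ρ, hρ, hρx⟩ := hdil n x hx fun u v u' v' h => by
    rw [hgram, hgram, hσ, hσ, ← hemul, ← hemul, h]
  have hnn := hpos.inner_nonneg (starLift e he1 hemul hσ ρ hρ) (x ⟨1, h1⟩)
  have hbsum : b = ∑ w : S, e.repr b w • e w := by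
    rw [Finset.sum_coe_sort S fun w => e.repr b w • e w]
    conv_lhs => rw [← e.linearCombination_repr b, Finsupp.linearCombination_apply,
      Finsupp.sum_of_support_subset _ hbS _ (by simp)]
  -- Pairing with `x 1` only involves products `1* w` with `w ∈ S`, so it suffices that `S` contains
  -- the support of `b` itself.
  have key : inner ℂ (x ⟨1, h1⟩) (starLift e he1 hemul hσ ρ hρ b (x ⟨1, h1⟩)) = l b := by
    conv_lhs => rw [hbsum]
    conv_rhs => rw [hbsum]
    simp only [map_sum, map_smul, starLift_basis, _root_.sum_apply,
      _root_.smul_apply, hρx, inner_sum, inner_smul_right, hgram, he1, star_one,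
      one_mul, smul_eq_mul]
  rw [key] at hnn
  exact hnn.not_gt hlb

end Criterion

/-! ### Suffix-closed sets of words. -/

section Suffixes

/-- A finite set of words is contained in a finite set of words closed under suffixes. -/
theorem exists_suffixClosed_finset {Y : Type*} (B : Finset (List Y)) :
    ∃ L : Finset (List Y), B ⊆ L ∧ [] ∈ L ∧ ∀ a l, a :: l ∈ L → l ∈ L := by
  classical
  refine ⟨insert [] (B.biUnion fun l => l.tails.toFinset), fun l hl => ?_, by simp,
    fun a l h => ?_⟩
  · exact Finset.mem_insert_of_mem (Finset.mem_biUnion.2 ⟨l, hl, by simp⟩)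
  · rcases Finset.mem_insert.1 h with h | h
    · simp at h
    · obtain ⟨m, hm, h⟩ := Finset.mem_biUnion.1 h
      refine Finset.mem_insert_of_mem (Finset.mem_biUnion.2 ⟨m, hm, ?_⟩)
      simp only [List.mem_toFinset, List.mem_tails] at h ⊢
      exact (List.suffix_cons a l).trans h

end Suffixes

/-! ### Free groups. -/

section FreeGroups

variable {X : Type*} {E : Type*} [NormedAddCommGroup E] [InnerProductSpace ℂ E]
  [FiniteDimensional ℂ E]

/-- A positive definite kernel on a finite set of reduced words closed under suffixes dilates to a
unitary representation of the free group. -/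
theorem exists_unitary_dilation {L : Finset (List (X × Bool))}
    (hL : ∀ a l, a :: l ∈ L → l ∈ L) {S : Finset (FreeGroup X)}
    (hLS : ∀ g, g ∈ S ↔ ∃ l ∈ L, FreeGroup.mk l = g) (h1 : 1 ∈ S)
    (x : S → E) (hx : LinearIndependent ℂ x)
    (hgram : ∀ u v u' v' : S, (u : FreeGroup X)⁻¹ * v = (u' : FreeGroup X)⁻¹ * v' →
      inner ℂ (x u) (x v) = inner ℂ (x u') (x v')) :
    ∃ ρ : FreeGroup X →* (E →L[ℂ] E), (∀ w, ρ w⁻¹ = star (ρ w)) ∧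
      ∀ w : S, ρ w (x ⟨1, h1⟩) = x w := by
  -- Since `(i g)⁻¹ (i h) = g⁻¹ h`, the partial shift `x g ↦ x (i g)` preserves the Gram matrix.
  have hU : ∀ i : X, ∃ U : unitary (E →L[ℂ] E),
      ∀ g : {g : S // FreeGroup.of i * (g : FreeGroup X) ∈ S},
        (U : E →L[ℂ] E) (x g) = x ⟨_, g.2⟩ := fun i => by
    refine exists_unitary_map_eq (hx.comp _ Subtype.val_injective) fun g h => hgram _ _ _ _ ?_
    simp [mul_assoc]
  choose U hU using hU
  let ρ : FreeGroup X →* unitary (E →L[ℂ] E) := FreeGroup.lift U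
  have hρ : ∀ l ∈ L, ∀ h : FreeGroup.mk l ∈ S,
      (ρ (FreeGroup.mk l) : E →L[ℂ] E) (x ⟨1, h1⟩) = x ⟨FreeGroup.mk l, h⟩ := by
    intro l
    induction l with
    | nil =>
      intro _ h
      have h0 : ρ (FreeGroup.mk []) = 1 := map_one ρ
      rw [h0]
      rfl
    | cons a l ih =>
      intro hal h
      have hl := hL a l hal
      have hlS : FreeGroup.mk l ∈ S := (hLS _).2 ⟨l, hl, rfl⟩
      have ih := ih hl hlS
      obtain ⟨i, _ | _⟩ := a
      · have hmk : FreeGroup.mk ((i, false) :: l) = (FreeGroup.of i)⁻¹ * FreeGroup.mk l := by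
          rw [FreeGroup.of, FreeGroup.inv_mk, FreeGroup.mul_mk]
          rfl
        have hl' : FreeGroup.mk l = FreeGroup.of i * FreeGroup.mk ((i, false) :: l) := by
          rw [hmk, mul_inv_cancel_left]
        -- For an inverse letter the shift is read backwards: `U i` sends the vector of the longer
        -- word to that of its suffix.
        have hUi := hU i ⟨⟨_, h⟩, hl' ▸ hlS⟩
        have hx' : x ⟨FreeGroup.of i * FreeGroup.mk ((i, false) :: l), hl' ▸ hlS⟩ =
            x ⟨FreeGroup.mk l, hlS⟩ := congrArg x (Subtype.ext hl'.symm)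
        rw [hx'] at hUi
        have hρi : ρ (FreeGroup.mk ((i, false) :: l)) = (U i)⁻¹ * ρ (FreeGroup.mk l) := by
          rw [hmk, map_mul, map_inv, FreeGroup.lift_apply_of]
        rw [hρi, Submonoid.coe_mul, mul_apply_eq_comp, ih, ← hUi,
          ← mul_apply_eq_comp, ← Submonoid.coe_mul, inv_mul_cancel]
        rfl
      · have hmk : FreeGroup.mk ((i, true) :: l) = FreeGroup.of i * FreeGroup.mk l := by
          simp [FreeGroup.of, FreeGroup.mul_mk]
        have hUi := hU i ⟨⟨_, hlS⟩, by rw [← hmk]; exact h⟩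
        have hρi : ρ (FreeGroup.mk ((i, true) :: l)) = U i * ρ (FreeGroup.mk l) := by
          rw [hmk, map_mul, FreeGroup.lift_apply_of]
        rw [hρi, Submonoid.coe_mul, mul_apply_eq_comp, ih, hUi]
        exact congrArg x (Subtype.ext hmk.symm)
  refine ⟨(Submonoid.subtype _).comp ρ, fun w => ?_, fun ⟨w, hw⟩ => ?_⟩
  · change ((ρ w⁻¹ : unitary (E →L[ℂ] E)) : E →L[ℂ] E) = _
    rw [map_inv]
    rfl
  · obtain ⟨l, hl, rfl⟩ := (hLS w).1 hw
    exact hρ l hl hw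

instance : StarModule ℂ (MonoidAlgebra ℂ (FreeGroup X)) := ⟨conjMap_smul _⟩

theorem freeGroup_mem_sumHermSq {b : MonoidAlgebra ℂ (FreeGroup X)} (hb : star b = b)
    (hpos : PosSemidefInFinDimReps b) : b ∈ sumHermSq (MonoidAlgebra ℂ (FreeGroup X)) := by
  classical
  let e : Module.Basis (FreeGroup X) ℂ (MonoidAlgebra ℂ (FreeGroup X)) := MonoidAlgebra.basis _ ℂ
  have he : ∀ w, e w = MonoidAlgebra.single w 1 := fun w => MonoidAlgebra.basis_apply ℂ w
  obtain ⟨L, hBL, hnil, hL⟩ :=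
    exists_suffixClosed_finset ((e.repr b).support.image FreeGroup.toWord)
  have h1 : (1 : FreeGroup X) ∈ L.image FreeGroup.mk :=
    Finset.mem_image.2 ⟨[], hnil, FreeGroup.one_eq_mk.symm⟩
  refine mem_sumHermSq_of_posSemidefInFinDimReps e (σ := fun g => g⁻¹) (S := L.image FreeGroup.mk)
    ?_ ?_ ?_ ?_ h1 ?_ ?_ hb hpos
  · rw [he]; rfl
  · simp [he]
  · simp [he, groupAlgebra_star_single]
  · rintro T ⟨w, hw⟩
    -- In a group any `w` will do, since `w⁻¹ w = 1` arises as `u⁻¹ v` only for `u = v`.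
    exact ⟨w, hw, fun u _ v _ h => by simpa [inv_mul_eq_one] using h⟩
  · exact fun n x hx hgram => exists_unitary_dilation hL (by simp) h1 x hx hgram
  · intro g hg
    exact Finset.mem_image.2 ⟨g.toWord, hBL (Finset.mem_image_of_mem _ hg), FreeGroup.mk_toWord⟩

end FreeGroups

/-! ### Free monoids with involution. -/

section FreeMonoids

variable {Y : Type*} {E : Type*} [NormedAddCommGroup E] [InnerProductSpace ℂ E]
  [FiniteDimensional ℂ E]

/-- A strictly positive definite kernel on a finite set of words closed under suffixes dilates to a
`*`-representation of the free monoid with involution. -/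
theorem exists_star_dilation {τ : Y → Y} (hτ : ∀ s, τ (τ s) = s)
    {σ : FreeMonoid Y → FreeMonoid Y} (hσ1 : σ 1 = 1) (hσmul : ∀ u v, σ (u * v) = σ v * σ u)
    (hσof : ∀ s, σ (FreeMonoid.of s) = FreeMonoid.of (τ s))
    {S : Finset (FreeMonoid Y)} (hS : ∀ s w, FreeMonoid.of s * w ∈ S → w ∈ S) (h1 : 1 ∈ S)
    (x : S → E) (hx : LinearIndependent ℂ x)
    (hgram : ∀ u v u' v' : S, σ u * v = σ u' * v' →
      inner ℂ (x u) (x v) = inner ℂ (x u') (x v')) :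
    ∃ ρ : FreeMonoid Y →* (E →L[ℂ] E), (∀ w, ρ (σ w) = star (ρ w)) ∧
      ∀ w : S, ρ w (x ⟨1, h1⟩) = x w := by
  have hZ : ∀ s : Y, ∃ Z : E →L[ℂ] E,
      (∀ w : {w : S // FreeMonoid.of s * (w : FreeMonoid Y) ∈ S}, Z (x w) = x ⟨_, w.2⟩) ∧
      ∀ w : {w : S // FreeMonoid.of (τ s) * (w : FreeMonoid Y) ∈ S},
        star Z (x w) = x ⟨_, w.2⟩ := fun s => by
    -- Compatibility is the identity `σ w' * (s w) = σ (τ s w') * w` together with the invariance of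
    -- the Gram matrix.
    refine exists_map_eq_and_star_map_eq (hx.comp _ Subtype.val_injective)
      (hx.comp _ Subtype.val_injective) fun w w' => hgram _ _ _ _ ?_
    simp [hσmul, hσof, hτ, mul_assoc]
  choose Z hZ hZ' using hZ
  -- The `Z s` are chosen independently, so `Z (τ s)` need not be the adjoint of `Z s`. Averaging
  -- enforces this and keeps the prescribed values, on which both summands agree.
  let W : Y → (E →L[ℂ] E) := fun s => (2⁻¹ : ℂ) • (Z s + star (Z (τ s)))
  have hW : ∀ s (w : {w : S // FreeMonoid.of s * (w : FreeMonoid Y) ∈ S}),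
      W s (x w) = x ⟨_, w.2⟩ := fun s w => by
    have h := hZ' (τ s) ⟨w, by rw [hτ]; exact w.2⟩
    simp only [hτ] at h
    simp only [W, _root_.smul_apply, _root_.add_apply, h, hZ, ← two_smul ℂ,
      smul_smul]
    norm_num
  have hWstar : ∀ s, W (τ s) = star (W s) := fun s => by
    simp [W, hτ, add_comm]
  let ρ : FreeMonoid Y →* (E →L[ℂ] E) := FreeMonoid.lift W
  have hρ : ∀ w (h : w ∈ S), ρ w (x ⟨1, h1⟩) = x ⟨w, h⟩ := by
    intro w
    induction w using FreeMonoid.inductionOn' with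
    | one => intro h; simp
    | of_mul s w ih =>
      intro h
      rw [map_mul, mul_apply_eq_comp, ih (hS s w h), FreeMonoid.lift_eval_of]
      exact hW s ⟨⟨w, hS s w h⟩, h⟩
  refine ⟨ρ, fun w => ?_, fun w => hρ w w.2⟩
  induction w using FreeMonoid.inductionOn' with
  | one => simp [hσ1]
  | of_mul s w ih =>
    rw [hσmul, map_mul, map_mul, ih, star_mul, hσof, FreeMonoid.lift_eval_of,
      FreeMonoid.lift_eval_of, hWstar]

/-- Treats both polynomial algebras at once: `τ` is the identity for hermitian variables and the
swap for the pairs `y`, `z`. -/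
theorem freeMonoid_mem_sumHermSq {A : Type*} [Ring A] [StarRing A] [Algebra ℂ A] [StarModule ℂ A]
    (e : Module.Basis (FreeMonoid Y) ℂ A) (he1 : e 1 = 1)
    (hemul : ∀ u v, e (u * v) = e u * e v) {τ : Y → Y} (hτ : ∀ s, τ (τ s) = s)
    {σ : FreeMonoid Y → FreeMonoid Y}
    (hσ : ∀ w, σ w = FreeMonoid.ofList (w.toList.map τ).reverse)
    (hstar : ∀ w, star (e w) = e (σ w)) {b : A} (hb : star b = b)
    (hpos : PosSemidefInFinDimReps b) : b ∈ sumHermSq A := by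
  classical
  obtain ⟨L, hBL, hnil, hL⟩ :=
    exists_suffixClosed_finset ((e.repr b).support.map FreeMonoid.toList.toEmbedding)
  have hmem : ∀ w, w ∈ L.map FreeMonoid.ofList.toEmbedding ↔ FreeMonoid.toList w ∈ L := fun w => by
    simp [Finset.mem_map_equiv]
  have hτinj : Function.Injective τ := Function.LeftInverse.injective hτ
  have hlen : ∀ w, (σ w).length = w.length := fun w => by
    rw [hσ]
    simp [FreeMonoid.length]
  have h1 : 1 ∈ L.map FreeMonoid.ofList.toEmbedding := (hmem 1).2 hnil
  refine mem_sumHermSq_of_posSemidefInFinDimReps e he1 hemul hstar ?_ h1 ?_ ?_ hb hpos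
  · intro T hT
    -- For `w` of maximal length, `σ u * v = σ w * w` forces `u` and `v` to have that length too,
    -- and comparing the two halves gives `u = w = v`.
    obtain ⟨w, hw, hmax⟩ := T.exists_max_image FreeMonoid.length hT
    refine ⟨w, hw, fun u hu v hv h => ?_⟩
    have hl := congrArg FreeMonoid.length h
    rw [FreeMonoid.length_mul, FreeMonoid.length_mul, hlen, hlen] at hl
    have hu' := hmax u hu
    have hv' := hmax v hv
    have h2 := List.append_inj (congrArg FreeMonoid.toList h)
      (show (σ u).length = (σ w).length by rw [hlen, hlen]; omega)
    have h3 : σ u = σ w := h2.1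
    rw [hσ, hσ] at h3
    have h4 : FreeMonoid.toList u = FreeMonoid.toList w :=
      List.map_injective_iff.2 hτinj (List.reverse_injective h3)
    exact FreeMonoid.toList.injective (h4.trans h2.2.symm)
  · refine fun n x hx hgram => exists_star_dilation hτ ?_ ?_ ?_ ?_ h1 x hx hgram
    · rw [hσ]; rfl
    · intro u v
      simp [hσ]
    · intro s
      rw [hσ]; rfl
    · intro s w h
      exact (hmem _).2 (hL s _ ((hmem _).1 h))
  · intro w hw
    exact (hmem w).2 (hBL (Finset.mem_map_of_mem _ hw))

end FreeMonoids

/-! ### The two polynomial algebras. -/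

section FreeAlgebras

variable {X : Type*}

instance : StarModule ℂ (HermFreeAlgebra X) := ⟨HermFreeAlgebra.star_smul⟩

instance : StarModule ℂ (PairFreeAlgebra X) := ⟨PairFreeAlgebra.star_smul⟩

theorem HermFreeAlgebra.mem_sumHermSq {b : HermFreeAlgebra X} (hb : star b = b)
    (hpos : PosSemidefInFinDimReps b) : b ∈ sumHermSq (HermFreeAlgebra X) := by
  let e : Module.Basis (FreeMonoid X) ℂ (HermFreeAlgebra X) :=
    (MonoidAlgebra.basis _ ℂ : Module.Basis (FreeMonoid X) ℂ (MonoidAlgebra ℂ (FreeMonoid X)))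
  have he : ∀ w, e w = (MonoidAlgebra.single w 1 : MonoidAlgebra ℂ (FreeMonoid X)) :=
    fun w => MonoidAlgebra.basis_apply ℂ w
  refine freeMonoid_mem_sumHermSq e (he 1) (fun u v => ?_) (τ := id) (fun _ => rfl)
    (σ := wordRev X) (fun w => by simp [wordRev]) (fun w => ?_) hb hpos
  · rw [he, he, he]
    exact (by simp : (MonoidAlgebra.single (u * v) 1 : MonoidAlgebra ℂ (FreeMonoid X)) =
      MonoidAlgebra.single u 1 * MonoidAlgebra.single v 1)
  · rw [he, he]
    exact (conjMap_single (wordRev X) w 1).trans (by rw [map_one])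

theorem PairFreeAlgebra.mem_sumHermSq {b : PairFreeAlgebra X} (hb : star b = b)
    (hpos : PosSemidefInFinDimReps b) : b ∈ sumHermSq (PairFreeAlgebra X) := by
  let e : Module.Basis (FreeMonoid (X ⊕ X)) ℂ (PairFreeAlgebra X) :=
    (MonoidAlgebra.basis _ ℂ :
      Module.Basis (FreeMonoid (X ⊕ X)) ℂ (MonoidAlgebra ℂ (FreeMonoid (X ⊕ X))))
  have he : ∀ w, e w = (MonoidAlgebra.single w 1 : MonoidAlgebra ℂ (FreeMonoid (X ⊕ X))) :=
    fun w => MonoidAlgebra.basis_apply ℂ w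
  refine freeMonoid_mem_sumHermSq e (he 1) (fun u v => ?_) (τ := Sum.swap) Sum.swap_swap
    (σ := wordRevSwap X) (fun w => by simp [wordRevSwap]) (fun w => ?_) hb hpos
  · rw [he, he, he]
    exact (by simp : (MonoidAlgebra.single (u * v) 1 : MonoidAlgebra ℂ (FreeMonoid (X ⊕ X))) =
      MonoidAlgebra.single u 1 * MonoidAlgebra.single v 1)
  · rw [he, he]
    exact (conjMap_single (wordRevSwap X) w 1).trans (by rw [map_one])

end FreeAlgebras

end FreeSOS

theorem theorem6p1 (X : Type*) :
    (∀ b : MonoidAlgebra ℂ (FreeGroup X), star b = b →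
      FreeSOS.PosSemidefInFinDimReps b →
        b ∈ FreeSOS.sumHermSq (MonoidAlgebra ℂ (FreeGroup X))) ∧
    (∀ b : FreeSOS.PairFreeAlgebra X, star b = b →
      FreeSOS.PosSemidefInFinDimReps b →
        b ∈ FreeSOS.sumHermSq (FreeSOS.PairFreeAlgebra X)) ∧
    (∀ b : FreeSOS.HermFreeAlgebra X, star b = b →
      FreeSOS.PosSemidefInFinDimReps b →
        b ∈ FreeSOS.sumHermSq (FreeSOS.HermFreeAlgebra X)) := by
  exact ⟨fun _ => FreeSOS.freeGroup_mem_sumHermSq, fun _ => FreeSOS.PairFreeAlgebra.mem_sumHermSq,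
    fun _ => FreeSOS.HermFreeAlgebra.mem_sumHermSq⟩
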